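/- Let $K$ be an algebraically closed field and let $n,m$ be non-negative integers. Write $\operatorname{Mat}_{n,n}^m$ for the $K$-vector space of $m$-tuples of $n\times n$ matrices over $K$. If a group $G$ acts on a finite-dimensional $K$-vector space $V$ by linear transformations, two points $v,w\in V$ are called closure equivalent if $\overline{G\cdot v}\cap\overline{G\cdot w}\neq\emptyset$, where the bar denotes closure in the Zariski topology of $V$. Write $\sim_C$ for closure equivalence with respect to the simultaneous conjugation action of $\operatorname{GL}_n(K)$ on $\operatorname{Mat}_{n,n}^m$, $$g\cdot(X_1,\dots,X_m)=(gX_1g^{-1},\dots,gX_mg^{-1}),$$ and $\sim_{LR}$ for closure equivalence with respect to the left-right action of $\operatorname{SL}_n(K)\times\operatorname{SL}_n(K)$ on $\operatorname{Mat}_{n,n}^{m+1}$, $$(P,Q)\cdot(X_1,\dots,X_{m+1})=(PX_1Q^{-1},\dots,PX_{m+1}Q^{-1}).$$ Then for all $A=(A_1,\dots,A_m)$ and $B=(B_1,\dots,B_m)$ in $\operatorname{Mat}_{n,n}^m$, $$A\sim_C B\quad\text{if and only if}\quad(\mathrm{Id},A_1,\dots,A_m)\sim_{LR}(\mathrm{Id},B_1,\dots,B_m).$$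 -/

import Mathlib

open scoped MatrixGroups

namespace OrbitClosure

section General

variable (K : Type*) [Field K] (V : Type*) [AddCommGroup V] [Module K V]

/-- The ring `K[V]` of polynomial functions on a `K`-vector space `V`: the `K`-subalgebra of the
algebra of all functions `V → K` that is generated by the linear forms. -/
def polynomialFunctions : Subalgebra K (V → K) :=
  Algebra.adjoin K (Set.range fun l : Module.Dual K V => (l : V → K))

variable {K V}

variable (K) in
/-- The Zariski closure of a subset `S` of `V`: the common zeros of all the polynomial functions
on `V` that vanish on `S`. -/
def zariskiClosure (S : Set V) : Set V :=
  {v | ∀ f ∈ polynomialFunctions K V, (∀ s ∈ S, f s = 0) → f v = 0}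

variable {G : Type*} [Group G]

/-- The orbit `G · v` for a linear action of the group `G` on `V`. -/
def orbit (ρ : Representation K G V) (v : V) : Set V :=
  Set.range fun g : G => ρ g v

/-- Closure equivalence: the Zariski closures of the orbits of `v` and `w` intersect. -/
def ClosureEquivalent (ρ : Representation K G V) (v w : V) : Prop :=
  (zariskiClosure K (orbit ρ v) ∩ zariskiClosure K (orbit ρ w)).Nonempty

end General

/-- The space of `m`-tuples of `n × n` matrices over `K`. -/
abbrev MatTuple (n m : ℕ) (K : Type*) : Type _ :=
  Fin m → Matrix (Fin n) (Fin n) K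

section Actions

variable (K : Type*) [Field K] (n m : ℕ)

/-- Simultaneous conjugation: `g · (X₁, …, Xₘ) = (g X₁ g⁻¹, …, g Xₘ g⁻¹)` for `g ∈ GLₙ(K)`. -/
def conjugation : Representation K (GL (Fin n) K) (MatTuple n m K) where
  toFun g :=
    { toFun := fun X i =>
        (g : Matrix (Fin n) (Fin n) K) * X i * ((g⁻¹ : GL (Fin n) K) : Matrix (Fin n) (Fin n) K)
      map_add' := fun X Y => by
        funext i
        simp only [Pi.add_apply, mul_add, add_mul]
      map_smul' := fun c X => by
        funext i
        simp only [Pi.smul_apply, Matrix.mul_smul, Matrix.smul_mul, RingHom.id_apply] }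
  map_one' := by
    refine LinearMap.ext fun X => funext fun i => ?_
    simp only [LinearMap.coe_mk, AddHom.coe_mk, Module.End.one_apply, inv_one, Units.val_one,
      one_mul, mul_one]
  map_mul' g h := by
    refine LinearMap.ext fun X => funext fun i => ?_
    simp only [LinearMap.coe_mk, AddHom.coe_mk, Module.End.mul_apply, mul_inv_rev, Units.val_mul,
      mul_assoc]

/-- The left-right action: `(P, Q) · (X₁, …, Xₘ) = (P X₁ Q⁻¹, …, P Xₘ Q⁻¹)` for
`(P, Q) ∈ SLₙ(K) × SLₙ(K)`. -/
def leftRight : Representation K (SL(n, K) × SL(n, K)) (MatTuple n m K) where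
  toFun p :=
    { toFun := fun X i =>
        (p.1 : Matrix (Fin n) (Fin n) K) * X i * ((p.2⁻¹ : SL(n, K)) : Matrix (Fin n) (Fin n) K)
      map_add' := fun X Y => by
        funext i
        simp only [Pi.add_apply, mul_add, add_mul]
      map_smul' := fun c X => by
        funext i
        simp only [Pi.smul_apply, Matrix.mul_smul, Matrix.smul_mul, RingHom.id_apply] }
  map_one' := by
    refine LinearMap.ext fun X => funext fun i => ?_
    simp only [LinearMap.coe_mk, AddHom.coe_mk, Module.End.one_apply, Prod.fst_one, Prod.snd_one,
      inv_one, Matrix.SpecialLinearGroup.coe_one, one_mul, mul_one]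
  map_mul' p q := by
    refine LinearMap.ext fun X => funext fun i => ?_
    simp only [LinearMap.coe_mk, AddHom.coe_mk, Module.End.mul_apply, Prod.fst_mul, Prod.snd_mul,
      mul_inv_rev, Matrix.SpecialLinearGroup.coe_mul, mul_assoc]

end Actions

/-- The map `φ : (X₁, …, Xₘ) ↦ (Id, X₁, …, Xₘ)`. -/
def prependId {K : Type*} [Field K] {n m : ℕ} (X : MatTuple n m K) : MatTuple n (m + 1) K :=
  Fin.cons 1 X

end OrbitClosure

namespace OrbitClosure

/-! A polynomial map that sends one orbit into another sends the closure of the first into the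
closure of the second, so it carries a common point of two orbit closures to a common point. Each
direction thus needs one polynomial map, independent of `A` and `B`. Forward: `prependId`, since
conjugation by `g` is also conjugation by an element of SL. Backward: multiply the tail by the
inverse of the leading matrix. On the orbits that matrix has determinant 1, so its inverse is its
adjugate, which is polynomial on the whole space; limit points need no invertibility argument. -/

section Polynomial

variable {K : Type*} [Field K] {V W : Type*} [AddCommGroup V] [Module K V] [AddCommGroup W]
  [Module K W]

variable (K) in
/-- A map between vector spaces that pulls linear forms back to polynomial functions. -/
def IsPolynomialMap (f : V → W) : Prop :=
  ∀ l : Module.Dual K W, (fun v => l (f v)) ∈ polynomialFunctions K V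

theorem IsPolynomialMap.comp_mem {f : V → W} (hf : IsPolynomialMap K f) {p : W → K}
    (hp : p ∈ polynomialFunctions K W) : (fun v => p (f v)) ∈ polynomialFunctions K V := by
  induction hp using Algebra.adjoin_induction with
  | mem x hx =>
    obtain ⟨l, rfl⟩ := hx
    exact hf l
  | algebraMap r => exact (polynomialFunctions K V).algebraMap_mem r
  | add x y _ _ hx hy => exact add_mem hx hy
  | mul x y _ _ hx hy => exact mul_mem hx hy

/-- If `p` vanishes on `T`, its pullback `p ∘ f` is a polynomial function vanishing on `S`. -/
theorem IsPolynomialMap.map_mem_zariskiClosure {f : V → W} (hf : IsPolynomialMap K f)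
    {S : Set V} {T : Set W} (hST : Set.MapsTo f S T) {v : V} (hv : v ∈ zariskiClosure K S) :
    f v ∈ zariskiClosure K T :=
  fun _ hp h => hv _ (hf.comp_mem hp) fun s hs => h (f s) (hST hs)

theorem const_mem_polynomialFunctions (c : K) :
    (fun _ => c) ∈ polynomialFunctions K V :=
  (polynomialFunctions K V).algebraMap_mem c

theorem linear_mem_polynomialFunctions (l : Module.Dual K V) :
    (fun v => l v) ∈ polynomialFunctions K V :=
  Algebra.subset_adjoin ⟨l, rfl⟩

theorem sum_mem_polynomialFunctions {ι : Type*} (s : Finset ι) {f : ι → V → K}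
    (hf : ∀ i ∈ s, f i ∈ polynomialFunctions K V) :
    (fun v => ∑ i ∈ s, f i v) ∈ polynomialFunctions K V := by
  have := sum_mem hf
  rwa [Finset.sum_fn] at this

theorem prod_mem_polynomialFunctions {ι : Type*} (s : Finset ι) {f : ι → V → K}
    (hf : ∀ i ∈ s, f i ∈ polynomialFunctions K V) :
    (fun v => ∏ i ∈ s, f i v) ∈ polynomialFunctions K V := by
  have := prod_mem hf
  rwa [Finset.prod_fn] at this

theorem det_mem_polynomialFunctions {n : ℕ} {M : V → Matrix (Fin n) (Fin n) K}
    (hM : ∀ i j, (fun v => M v i j) ∈ polynomialFunctions K V) :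
    (fun v => (M v).det) ∈ polynomialFunctions K V := by
  simp only [Matrix.det_apply']
  exact sum_mem_polynomialFunctions _ fun σ _ =>
    mul_mem (const_mem_polynomialFunctions _) (prod_mem_polynomialFunctions _ fun i _ => hM _ _)

theorem adjugate_mem_polynomialFunctions {n : ℕ} {M : V → Matrix (Fin n) (Fin n) K}
    (hM : ∀ i j, (fun v => M v i j) ∈ polynomialFunctions K V) (i j : Fin n) :
    (fun v => (M v).adjugate i j) ∈ polynomialFunctions K V := by
  simp only [Matrix.adjugate_apply]
  -- The cofactor is the determinant of `M v` with row `j` replaced by a constant unit vector.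
  refine det_mem_polynomialFunctions fun a b => ?_
  by_cases h : a = j
  · simpa [Matrix.updateRow_apply, h] using const_mem_polynomialFunctions _
  · simpa [Matrix.updateRow_apply, h] using hM a b

/-- Every linear form on tuples is a linear combination of the matrix entries. -/
theorem isPolynomialMap_of_entries {n m : ℕ} {f : V → MatTuple n m K}
    (hf : ∀ k i j, (fun v => f v k i j) ∈ polynomialFunctions K V) : IsPolynomialMap K f := by
  intro l
  have key : ∀ X : MatTuple n m K,
      l X = ∑ k, ∑ i, ∑ j, X k i j * l (Pi.single k (Matrix.single i j 1)) := by
    intro X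
    have hX : X = ∑ k, ∑ i, ∑ j, X k i j • Pi.single k (Matrix.single i j (1 : K)) := by
      conv_lhs => rw [← Finset.univ_sum_single X]
      refine Finset.sum_congr rfl fun k _ => ?_
      conv_lhs => rw [Matrix.matrix_eq_sum_single (X k)]
      simp only [← Pi.single_smul, Matrix.smul_single, smul_eq_mul, mul_one]
      exact (map_sum (AddMonoidHom.single (fun _ : Fin m => Matrix (Fin n) (Fin n) K) k) _ _).trans
        (Finset.sum_congr rfl fun i _ => map_sum (AddMonoidHom.single _ k) _ _)
    conv_lhs => rw [hX]
    simp only [map_sum, map_smul, smul_eq_mul]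
  rw [show (fun v => l (f v)) = _ from funext fun v => key (f v)]
  exact sum_mem_polynomialFunctions _ fun k _ => sum_mem_polynomialFunctions _ fun i _ =>
    sum_mem_polynomialFunctions _ fun j _ => mul_mem (hf k i j) (const_mem_polynomialFunctions _)

end Polynomial

section Matrices

variable {K : Type*} [Field K] {n m : ℕ}

theorem entry_mem_polynomialFunctions (k : Fin m) (i j : Fin n) :
    (fun X : MatTuple n m K => X k i j) ∈ polynomialFunctions K (MatTuple n m K) :=
  linear_mem_polynomialFunctions (V := MatTuple n m K)
    ((Matrix.entryLinearMap K K i j).comp (LinearMap.proj (R := K) k))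

theorem isPolynomialMap_prependId :
    IsPolynomialMap K (prependId : MatTuple n m K → MatTuple n (m + 1) K) := by
  refine isPolynomialMap_of_entries fun k i j => ?_
  cases k using Fin.cases with
  | zero => exact const_mem_polynomialFunctions _
  | succ k => exact entry_mem_polynomialFunctions k i j

/-- The map `(X₀, …, Xₘ) ↦ (adj(X₀) X₁, …, adj(X₀) Xₘ)`. -/
def adjugateMulTail (X : MatTuple n (m + 1) K) : MatTuple n m K :=
  fun k => (X 0).adjugate * X k.succ

theorem isPolynomialMap_adjugateMulTail :
    IsPolynomialMap K (adjugateMulTail : MatTuple n (m + 1) K → MatTuple n m K) := by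
  refine isPolynomialMap_of_entries fun k i j => ?_
  simp only [adjugateMulTail, Matrix.mul_apply]
  exact sum_mem_polynomialFunctions _ fun a _ =>
    mul_mem (adjugate_mem_polynomialFunctions (fun _ _ => entry_mem_polynomialFunctions _ _ _) _ _)
      (entry_mem_polynomialFunctions _ _ _)

/-- At `(P, Q)` the leading matrix is `P Q⁻¹`, with adjugate `Q P⁻¹`, and `Q P⁻¹ · P Aₖ Q⁻¹ = Q Aₖ
Q⁻¹`. -/
theorem adjugateMulTail_mapsTo_orbit (A : MatTuple n m K) :
    Set.MapsTo adjugateMulTail (orbit (leftRight K n (m + 1)) (prependId A))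
      (orbit (conjugation K n m) A) := by
  rintro _ ⟨⟨P, Q⟩, rfl⟩
  refine ⟨(Q : GL (Fin n) K), funext fun k => ?_⟩
  have h : ((P : Matrix (Fin n) (Fin n) K) * ((Q⁻¹ : SL(n, K)) : Matrix (Fin n) (Fin n) K)).adjugate
      = (Q : Matrix (Fin n) (Fin n) K) * ((P⁻¹ : SL(n, K)) : Matrix (Fin n) (Fin n) K) := by
    rw [← Matrix.SpecialLinearGroup.coe_mul, ← Matrix.SpecialLinearGroup.coe_inv,
      ← Matrix.SpecialLinearGroup.coe_mul, mul_inv_rev, inv_inv]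
  have hP : ((P⁻¹ : SL(n, K)) : Matrix (Fin n) (Fin n) K) * (P : Matrix (Fin n) (Fin n) K) = 1 := by
    rw [← Matrix.SpecialLinearGroup.coe_mul, inv_mul_cancel, Matrix.SpecialLinearGroup.coe_one]
  change (Q : Matrix (Fin n) (Fin n) K) * A k * ((Q⁻¹ : SL(n, K)) : Matrix (Fin n) (Fin n) K) =
    ((P : Matrix (Fin n) (Fin n) K) * 1 *
      ((Q⁻¹ : SL(n, K)) : Matrix (Fin n) (Fin n) K)).adjugate *
      ((P : Matrix (Fin n) (Fin n) K) * A k * ((Q⁻¹ : SL(n, K)) : Matrix (Fin n) (Fin n) K))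
  rw [mul_one, h]
  simp only [mul_assoc]
  rw [← mul_assoc ((P⁻¹ : SL(n, K)) : Matrix (Fin n) (Fin n) K), hP, one_mul]

/-- Scalars cancel in conjugation, so `g` may be divided by an `n`-th root `c` of its determinant.
-/
theorem exists_specialLinearGroup_conj_eq [IsAlgClosed K] (g : GL (Fin n) K) :
    ∃ P : SL(n, K), ∀ X : Matrix (Fin n) (Fin n) K,
      (P : Matrix (Fin n) (Fin n) K) * X * ((P⁻¹ : SL(n, K)) : Matrix (Fin n) (Fin n) K) =
        (g : Matrix (Fin n) (Fin n) K) * X * ((g⁻¹ : GL (Fin n) K) : Matrix (Fin n) (Fin n) K) := by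
  rcases Nat.eq_zero_or_pos n with rfl | hn
  · exact ⟨1, fun X => Subsingleton.elim _ _⟩
  obtain ⟨c, hc⟩ := IsAlgClosed.exists_pow_nat_eq (g : Matrix (Fin n) (Fin n) K).det hn
  have hdet : (g : Matrix (Fin n) (Fin n) K).det ≠ 0 :=
    ((Matrix.isUnit_iff_isUnit_det _).1 g.isUnit).ne_zero
  have hc0 : c ≠ 0 := by
    rintro rfl
    exact hdet (by rw [← hc, zero_pow hn.ne'])
  let P : SL(n, K) := ⟨c⁻¹ • (g : Matrix (Fin n) (Fin n) K), by
    rw [Matrix.det_smul, Fintype.card_fin, ← hc, inv_pow, inv_mul_cancel₀ (pow_ne_zero _ hc0)]⟩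
  have hP : (P : Matrix (Fin n) (Fin n) K) = c⁻¹ • (g : Matrix (Fin n) (Fin n) K) := rfl
  have hinv : ((P⁻¹ : SL(n, K)) : Matrix (Fin n) (Fin n) K) =
      c • ((g⁻¹ : GL (Fin n) K) : Matrix (Fin n) (Fin n) K) := by
    refine left_inv_eq_right_inv (a := (P : Matrix (Fin n) (Fin n) K)) ?_ ?_
    · rw [← Matrix.SpecialLinearGroup.coe_mul, inv_mul_cancel, Matrix.SpecialLinearGroup.coe_one]
    · rw [hP, Matrix.smul_mul, Matrix.mul_smul, smul_smul, inv_mul_cancel₀ hc0, one_smul,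
        Units.mul_inv]
  refine ⟨P, fun X => ?_⟩
  rw [hinv, hP, Matrix.smul_mul, Matrix.smul_mul, Matrix.mul_smul, smul_smul, inv_mul_cancel₀ hc0,
    one_smul]

theorem prependId_mapsTo_orbit [IsAlgClosed K] (A : MatTuple n m K) :
    Set.MapsTo prependId (orbit (conjugation K n m) A)
      (orbit (leftRight K n (m + 1)) (prependId A)) := by
  rintro _ ⟨g, rfl⟩
  obtain ⟨P, hP⟩ := exists_specialLinearGroup_conj_eq g
  -- A diagonal pair fixes the leading identity.
  refine ⟨(P, P), funext fun k => ?_⟩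
  cases k using Fin.cases with
  | zero => exact (hP 1).trans (by rw [mul_one, Units.mul_inv]; rfl)
  | succ k => exact hP (A k)

end Matrices

end OrbitClosure

theorem corollary3p2 {K : Type*} [Field K] [IsAlgClosed K] (n m : ℕ)
    (A B : OrbitClosure.MatTuple n m K) :
    OrbitClosure.ClosureEquivalent (OrbitClosure.conjugation K n m) A B ↔
      OrbitClosure.ClosureEquivalent (OrbitClosure.leftRight K n (m + 1))
        (OrbitClosure.prependId A) (OrbitClosure.prependId B) := by
  constructor
  · rintro ⟨Z, hA, hB⟩
    have h := OrbitClosure.isPolynomialMap_prependId (K := K) (n := n) (m := m)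
    exact ⟨_, h.map_mem_zariskiClosure (OrbitClosure.prependId_mapsTo_orbit A) hA,
      h.map_mem_zariskiClosure (OrbitClosure.prependId_mapsTo_orbit B) hB⟩
  · rintro ⟨Z, hA, hB⟩
    have h := OrbitClosure.isPolynomialMap_adjugateMulTail (K := K) (n := n) (m := m)
    exact ⟨_, h.map_mem_zariskiClosure (OrbitClosure.adjugateMulTail_mapsTo_orbit A) hA,
      h.map_mem_zariskiClosure (OrbitClosure.adjugateMulTail_mapsTo_orbit B) hB⟩
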